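/- **Setting.** Let $d$ be a dimension, let $\mathscr S(\mathbb R^d)$ be the real Schwartz space, and put $|||f|||=(\|f\|_{L^1(\mathbb R^d)}^2+\|f\|_{L^2(\mathbb R^d)}^2)^{1/2}$ on $L^1(\mathbb R^d)\cap L^2(\mathbb R^d)$. A generalized random field indexed by a topological vector space $V$ is a family $(Z(f))_{f\in V}$ of real random variables on a probability space $(\Omega,\mathfrak A,\mathbf P)$ that is a.s. linear in $f$ and continuous in probability. Let $\nu$ be a finite Borel measure on $\mathbb R\setminus\{0\}$, and let $\nu_+$ be its image under $s\mapsto|s|$. Let $P$ be a compound Poisson field with Lévy measure $\nu$, i.e. a generalized random field indexed by $\mathscr S(\mathbb R^d)$ with $$\mathbf E\,e^{iP(f)}=\exp\Big(\int_{\mathbb R^d}\psi(f(x))\,dx\Big)\quad(f\in\mathscr S(\mathbb R^d)),\qquad \psi(t)=ibt+\int_{\mathbb R\setminus\{0\}}\big(e^{its}-1-its\mathbf 1_{\{|s|\le1\}}\big)\,\nu(ds),\qquad b=\int_{\{0<|s|\le1\}}s\,\nu(ds)$$ (a Lévy field with characteristic triplet $(b,0,\nu)$; in particular $\psi\circ f\in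 L^1(\mathbb R^d)$). Assume that $P$ is $|||\cdot|||$-continuous in probability, that $\int|s|\,\nu(ds)<\infty$, and that $\int(e^{\beta s}-1)\,\nu_+(ds)<\infty$ for some $\beta>0$. The unique extension of $P$ to a $|||\cdot|||$-continuous generalized random field indexed by $L^1(\mathbb R^d)\cap L^2(\mathbb R^d)$ is again denoted by $P$. A smoothing function is a function $k:\mathbb R^d\times\mathbb R^d\to\mathbb R$ such that $k(x,\cdot)\in L^1(\mathbb R^d)\cap L^2(\mathbb R^d)$ for every $x$ and $x\mapsto k(x,\cdot)$ is $|||\cdot|||$-continuous; one puts $P_k(x):=P(k(x,\cdot))$, a random variable modulo a.s. equality. Let $D\subseteq\mathbb R^d$ be open and bounded, let $(k_\iota)_{\iota\in I}$ be a family of smoothing functions, and put $\tilde k_\iota(y):=\sup_{x\in D}|k_\iota(x,y)|\in[0,\infty]$. Assume that $\tilde k_\iota\in L^1(\mathbb R^d)\cap L^\infty(\mathbb R^d)$ for every $\iota\in I$ and that $$\kappa_1:=\sup_{\iota\in I}\|\tilde k_\iota\|_{L^1(\mathbb R^d)}<\infty,\qquad 0<\kappa_\infty:=\sup_{\iota\in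 I}\|\tilde k_\iota\|_{L^\infty(\mathbb R^d)}<\infty .$$ **Claim.** For all $\iota\in I$, $\tau\in(0,1)$ and $p>0$, $$\mathbf P\Big(\sup_{x\in D}|P_{k_\iota}(x)|\ge p\Big)\le\exp\left(\frac{\beta\kappa_1}{\kappa_\infty}\left(e^{\beta}\int_{\{0<s\le1\}}|s|\,\nu_+(ds)+\frac{1}{\beta e(1-\tau)}\int_{\{s>1\}}e^{\beta s}\,\nu_+(ds)\right)\right)e^{-\frac{\beta}{\kappa_\infty}\tau p}.$$ Here the supremum is the one in the ordered space of $[0,\infty]$-valued random variables modulo a.s. equality (the essential supremum of the family $(|P_{k_\iota}(x)|)_{x\in D}$; that it exists is part of the claim). The same bound holds for the pathwise supremum over $D$ of every version of $(P_{k_\iota}(x))_{x\in D}$ whose pathwise supremum over $D$ of the absolute value is a.s. equal to that over some countable subset of $D$ (for example, every version with a.s. continuous paths on $D$). -/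

import Mathlib

open MeasureTheory Filter Topology
open scoped ENNReal SchwartzMap

namespace LevyField

/-- The space `ℝ^d` with its Euclidean norm and Lebesgue measure. -/
abbrev Rd (d : ℕ) : Type := EuclideanSpace ℝ (Fin d)

/-- The space `L¹(ℝ^d) ∩ L²(ℝ^d)` with the norm `(‖f‖_{L¹}² + ‖f‖_{L²}²)^{1/2}`: an element is
a pair of classes, one in `L¹` and one in `L²`, which are almost everywhere equal. -/
def L1L2 (d : ℕ) :
    Submodule ℝ (WithLp 2 (Lp ℝ 1 (volume : Measure (Rd d)) × Lp ℝ 2 (volume : Measure (Rd d)))) where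
  carrier := {p | (p.fst : Rd d → ℝ) =ᵐ[volume] (p.snd : Rd d → ℝ)}
  add_mem' := by
    intro p q hp hq
    have hp' : (p.fst : Rd d → ℝ) =ᵐ[volume] (p.snd : Rd d → ℝ) := hp
    have hq' : (q.fst : Rd d → ℝ) =ᵐ[volume] (q.snd : Rd d → ℝ) := hq
    change ((p.fst + q.fst : Lp ℝ 1 (volume : Measure (Rd d))) : Rd d → ℝ) =ᵐ[volume]
      ((p.snd + q.snd : Lp ℝ 2 (volume : Measure (Rd d))) : Rd d → ℝ)
    filter_upwards [Lp.coeFn_add p.fst q.fst, Lp.coeFn_add p.snd q.snd, hp', hq']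
      with x h1 h2 h3 h4
    rw [h1, h2, Pi.add_apply, Pi.add_apply, h3, h4]
  zero_mem' := by
    change ((0 : Lp ℝ 1 (volume : Measure (Rd d))) : Rd d → ℝ) =ᵐ[volume]
      ((0 : Lp ℝ 2 (volume : Measure (Rd d))) : Rd d → ℝ)
    filter_upwards [Lp.coeFn_zero ℝ 1 (volume : Measure (Rd d)),
      Lp.coeFn_zero ℝ 2 (volume : Measure (Rd d))] with x h1 h2
    rw [h1, h2]
  smul_mem' := by
    intro c p hp
    have hp' : (p.fst : Rd d → ℝ) =ᵐ[volume] (p.snd : Rd d → ℝ) := hp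
    change ((c • p.fst : Lp ℝ 1 (volume : Measure (Rd d))) : Rd d → ℝ) =ᵐ[volume]
      ((c • p.snd : Lp ℝ 2 (volume : Measure (Rd d))) : Rd d → ℝ)
    filter_upwards [Lp.coeFn_smul c p.fst, Lp.coeFn_smul c p.snd, hp'] with x h1 h2 h3
    rw [h1, h2, Pi.smul_apply, Pi.smul_apply, h3]

/-- The element of `L¹ ∩ L²` given by a function that belongs to both spaces. -/
noncomputable def toL1L2 {d : ℕ} (f : Rd d → ℝ) (h1 : MemLp f 1 volume) (h2 : MemLp f 2 volume) :
    L1L2 d :=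
  ⟨WithLp.toLp 2 (h1.toLp f, h2.toLp f), h1.coeFn_toLp.trans h2.coeFn_toLp.symm⟩

/-- The inclusion of the real Schwartz space into `L¹ ∩ L²`. -/
noncomputable def schwartzToL1L2 {d : ℕ} (f : 𝓢(Rd d, ℝ)) : L1L2 d :=
  toL1L2 f (f.memLp 1 volume) (f.memLp 2 volume)

section Fields

variable {Ω : Type*} [MeasurableSpace Ω]

/-- A generalized random field indexed by `V`: a family of real random variables that is almost
surely linear and continuous in probability in the index. -/
structure IsGeneralizedRandomField {V : Type*} [AddCommGroup V] [Module ℝ V] [TopologicalSpace V]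
    (μ : Measure Ω) (Z : V → Ω → ℝ) : Prop where
  measurable : ∀ f, Measurable (Z f)
  linear : ∀ (a b : ℝ) (f g : V), Z (a • f + b • g) =ᵐ[μ] fun ω => a * Z f ω + b * Z g ω
  stochContinuous : ∀ f₀ : V, TendstoInMeasure μ Z (𝓝 f₀) (Z f₀)

/-- Continuity in probability of a field indexed by Schwartz functions with respect to the norm
of `L¹ ∩ L²`. -/
def IsTripleNormContinuous {d : ℕ} (μ : Measure Ω) (Z : 𝓢(Rd d, ℝ) → Ω → ℝ) : Prop :=
  ∀ f₀ : 𝓢(Rd d, ℝ),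
    TendstoInMeasure μ Z (comap schwartzToL1L2 (𝓝 (schwartzToL1L2 f₀))) (Z f₀)

/-- A (σ-finite) Borel measure on `ℝ \ {0}`, seen as a measure on `ℝ` that does not charge `0`,
with `∫ min(1, s²) dν < ∞`. -/
structure IsLevyMeasure (ν : Measure ℝ) : Prop where
  sigmaFinite : SigmaFinite ν
  zero : ν {0} = 0
  integrable : ∫⁻ s, ENNReal.ofReal (min 1 (s ^ 2)) ∂ν < ∞

/-- The Lévy characteristic with characteristic triplet `(b, σ², ν)`. -/
noncomputable def levyCharacteristic (b σsq : ℝ) (ν : Measure ℝ) (t : ℝ) : ℂ :=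
  Complex.I * b * t - (σsq : ℂ) * (t : ℂ) ^ 2 / 2
    + ∫ s : ℝ, (Complex.exp (Complex.I * t * s) - 1
        - Set.indicator {s : ℝ | |s| ≤ 1} (fun s : ℝ => Complex.I * t * s) s) ∂ν

/-- `Z` is a Lévy noise field associated with the characteristic triplet `(b, σ², ν)`. -/
structure IsLevyNoiseField {d : ℕ} (μ : Measure Ω) (Z : 𝓢(Rd d, ℝ) → Ω → ℝ)
    (b σsq : ℝ) (ν : Measure ℝ) : Prop where
  field : IsGeneralizedRandomField μ Z
  sigma_nonneg : 0 ≤ σsq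
  levyMeasure : IsLevyMeasure ν
  integrable : ∀ f : 𝓢(Rd d, ℝ), Integrable (fun x => levyCharacteristic b σsq ν (f x)) volume
  charFunctional : ∀ f : 𝓢(Rd d, ℝ),
    ∫ ω, Complex.exp (Complex.I * (Z f ω : ℂ)) ∂μ
      = Complex.exp (∫ x, levyCharacteristic b σsq ν (f x))

/-- The image `ν₊` of a measure on `ℝ \ {0}` under `s ↦ |s|`. -/
noncomputable def absMeasure (ν : Measure ℝ) : Measure ℝ := ν.map (fun s => |s|)

/-- A compound Poisson field: a Lévy field with finite `ν` and
triplet `(∫_{0 < |s| ≤ 1} s dν, 0, ν)`. -/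
structure IsCompoundPoissonField {d : ℕ} (μ : Measure Ω) (P : 𝓢(Rd d, ℝ) → Ω → ℝ)
    (ν : Measure ℝ) : Prop where
  finite : IsFiniteMeasure ν
  levy : IsLevyNoiseField μ P (∫ s in {s : ℝ | 0 < |s| ∧ |s| ≤ 1}, s ∂ν) 0 ν

/-- `Zext` is the continuous extension to `L¹ ∩ L²` of the field `Z` indexed by Schwartz
functions (up to almost sure equality it is unique, and it exists when `Z` is continuous with
respect to the norm of `L¹ ∩ L²`). -/
structure IsExtension {d : ℕ} (μ : Measure Ω) (Z : 𝓢(Rd d, ℝ) → Ω → ℝ)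
    (Zext : L1L2 d → Ω → ℝ) : Prop where
  field : IsGeneralizedRandomField μ Zext
  agree : ∀ f : 𝓢(Rd d, ℝ), Zext (schwartzToL1L2 f) =ᵐ[μ] Z f

/-- A bivariate smoothing function: `k(x, ·) ∈ L¹ ∩ L²` for every `x`, and `x ↦ k(x, ·)` is
continuous into `L¹ ∩ L²`. -/
structure IsSmoothingFunction {d : ℕ} (k : Rd d → Rd d → ℝ) : Prop where
  memL1 : ∀ x, MemLp (k x) 1 volume
  memL2 : ∀ x, MemLp (k x) 2 volume
  continuous : Continuous fun x => toL1L2 (k x) (memL1 x) (memL2 x)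

/-- The smoothed random field `Z_k(x) = Z(k(x, ·))`, for `Z` indexed by `L¹ ∩ L²`. -/
noncomputable def smoothedField {d : ℕ} (Z : L1L2 d → Ω → ℝ) {k : Rd d → Rd d → ℝ}
    (hk : IsSmoothingFunction k) (x : Rd d) : Ω → ℝ :=
  Z (toL1L2 (k x) (hk.memL1 x) (hk.memL2 x))

/-- `M` is the supremum over `x ∈ D` of the family `Y x` in the ordered space of random variables
with values in `[0, ∞]` modulo almost sure equality (the essential supremum of the family). -/
structure IsEssSupOfFamily {T : Type*} (μ : Measure Ω) (D : Set T) (Y : T → Ω → ℝ≥0∞)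
    (M : Ω → ℝ≥0∞) : Prop where
  measurable : Measurable M
  le : ∀ x ∈ D, Y x ≤ᵐ[μ] M
  least : ∀ M' : Ω → ℝ≥0∞, Measurable M' → (∀ x ∈ D, Y x ≤ᵐ[μ] M') → M ≤ᵐ[μ] M'

/-- The pathwise supremum of `|Y|` over `D` is almost surely equal to the supremum over a
countable subset of `D` (as for almost surely continuous paths, or separable versions). -/
def HasCountableSup {T : Type*} (μ : Measure Ω) (D : Set T) (Y : T → Ω → ℝ) : Prop :=
  ∃ S : Set T, S ⊆ D ∧ S.Countable ∧
    ∀ᵐ ω ∂μ, (⨆ x ∈ D, ‖Y x ω‖ₑ) = ⨆ x ∈ S, ‖Y x ω‖ₑ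

end Fields

/-- `y ↦ sup_{x ∈ D} |k(x, y)|`, with values in `[0, ∞]`. -/
noncomputable def kernelSup {d : ℕ} (D : Set (Rd d)) (k : Rd d → Rd d → ℝ) (y : Rd d) : ℝ≥0∞ :=
  ⨆ x ∈ D, ‖k x y‖ₑ

/-- `sup_i ‖sup_{x ∈ D} |k_i(x, ·)|‖_{L^q}`, with values in `[0, ∞]`. -/
noncomputable def kernelSupNorm {d : ℕ} {I : Type*} (D : Set (Rd d)) (k : I → Rd d → Rd d → ℝ)
    (q : ℝ≥0∞) : ℝ≥0∞ :=
  ⨆ i, eLpNorm (kernelSup D (k i)) q volume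

end LevyField

/-! For finitely many `g j` vanishing outside a ball `B`, put `F = (g j)_j`. The characteristic
functional shows that the random vector `(P (g j))_j` has a compound Poisson law, whose jump measure
`m` is the image of `ν ⊗ dy` on `ℝ × B` under `(s, y) ↦ s F(y)`. For the sup norm on `ι → ℝ`, the
weight `w v = exp (θ ‖v‖)` is submultiplicative, so the series of convolution powers gives `E w ≤
exp (∫ (w - 1) dm)`. Since `e^x - 1 ≤ x e^x`, this exponent is at most `θ κ1 ∫ |s| exp (θ κinf |s|)
dν`, where `κ1` and `κinf` bound the `L¹` and `L^∞` norms of `‖F‖`.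

When the `g j` are kernels `k (x j, ·)` with `x j ∈ D`, `‖F‖` is dominated by `kernelSup D k`, so
the estimate does not depend on the number of points. Markov's inequality with `θ = β τ / κinf`
bounds finite maxima. Truncation to balls is removed by continuity in probability; monotone limits
give the supremum over a dense sequence of `D`, which is the essential supremum of the family.

The main lemmas are `lintegral_compoundPoisson_le`, `charFunDual_extension`,
`lintegral_jumpMeasure_le` and `measure_exists_ge_le`. -/

namespace LevyField

/-! ### Compound Poisson laws and their exponential moments. -/

section CompoundPoisson

variable {E : Type*} [NormedAddCommGroup E] [MeasurableSpace E] [BorelSpace E]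
  [SecondCountableTopology E]

/-- The `n`-fold convolution power of a measure. -/
noncomputable def convPow (m : Measure E) : ℕ → Measure E
  | 0 => Measure.dirac 0
  | n + 1 => (convPow m n).conv m

/-- The compound Poisson law `e^{-m(E)} ∑ m^{*n} / n!` of a finite measure `m`. -/
noncomputable def compoundPoisson (m : Measure E) : Measure E :=
  Measure.sum fun n : ℕ =>
    ENNReal.ofReal (Real.exp (-m.real Set.univ) / n.factorial) • convPow m n

instance isFiniteMeasure_convPow (m : Measure E) [IsFiniteMeasure m] (n : ℕ) :
    IsFiniteMeasure (convPow m n) := by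
  induction n with
  | zero => unfold convPow; infer_instance
  | succ n ih => unfold convPow; infer_instance

theorem lintegral_convPow_le (m : Measure E) [IsFiniteMeasure m] {w : E → ℝ≥0∞}
    (hw : Measurable w) (hw0 : w 0 ≤ 1) (hmul : ∀ x y, w (x + y) ≤ w x * w y) (n : ℕ) :
    ∫⁻ x, w x ∂(convPow m n) ≤ (∫⁻ x, w x ∂m) ^ n := by
  induction n with
  | zero => simpa [convPow, lintegral_dirac' _ hw] using hw0
  | succ n ih =>
    rw [convPow, Measure.lintegral_conv hw, pow_succ]
    calc ∫⁻ x, ∫⁻ y, w (x + y) ∂m ∂(convPow m n)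
        ≤ ∫⁻ x, ∫⁻ y, w x * w y ∂m ∂(convPow m n) := by gcongr; exact hmul _ _
      _ = ∫⁻ x, w x * ∫⁻ y, w y ∂m ∂(convPow m n) := by
          simp_rw [lintegral_const_mul _ hw]
      _ = (∫⁻ x, w x ∂(convPow m n)) * ∫⁻ y, w y ∂m := lintegral_mul_const _ hw
      _ ≤ _ := by gcongr

/-- With `a = m(E)`, the `n`-th convolution power contributes at most `e^{-a} (a + C)^n / n!`, and
these terms sum to `e^C`. The constant `C` plays the role of `∫ (w - 1) dm`. -/
theorem lintegral_compoundPoisson_le (m : Measure E) [IsFiniteMeasure m] {w : E → ℝ≥0∞}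
    (hw : Measurable w) (hw0 : w 0 ≤ 1) (hmul : ∀ x y, w (x + y) ≤ w x * w y) {C : ℝ}
    (hC0 : 0 ≤ C) (hC : ∫⁻ x, w x ∂m ≤ ENNReal.ofReal (m.real Set.univ + C)) :
    ∫⁻ x, w x ∂(compoundPoisson m) ≤ ENNReal.ofReal (Real.exp C) := by
  set a := m.real Set.univ with ha
  have ha0 : 0 ≤ a := measureReal_nonneg
  have hsum : HasSum (fun n : ℕ => Real.exp (-a) / n.factorial * (a + C) ^ n) (Real.exp C) := by
    have h := (NormedSpace.expSeries_div_hasSum_exp (a + C)).mul_left (Real.exp (-a))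
    rw [← Real.exp_eq_exp_ℝ, ← Real.exp_add, neg_add_cancel_left] at h
    simpa only [div_mul_eq_mul_div, mul_div_assoc] using h
  rw [compoundPoisson, lintegral_sum_measure]
  calc ∑' n : ℕ, ∫⁻ x, w x ∂(ENNReal.ofReal (Real.exp (-a) / n.factorial) • convPow m n)
      ≤ ∑' n : ℕ, ENNReal.ofReal (Real.exp (-a) / n.factorial * (a + C) ^ n) := by
        refine ENNReal.tsum_le_tsum fun n => ?_
        rw [lintegral_smul_measure, smul_eq_mul, ENNReal.ofReal_mul (by positivity),
          ENNReal.ofReal_pow (by positivity)]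
        gcongr
        exact (lintegral_convPow_le m hw hw0 hmul n).trans (by gcongr)
    _ = ENNReal.ofReal (Real.exp C) := by
        rw [← ENNReal.ofReal_tsum_of_nonneg (fun n => by positivity) hsum.summable,
          hsum.tsum_eq]

instance isFiniteMeasure_compoundPoisson (m : Measure E) [IsFiniteMeasure m] :
    IsFiniteMeasure (compoundPoisson m) := by
  refine ⟨?_⟩
  have h := lintegral_compoundPoisson_le m (w := fun _ => 1) measurable_const le_rfl
    (fun _ _ => by simp) (C := 0) le_rfl (by simp [Measure.real])
  simp only [lintegral_one] at h
  exact h.trans_lt ENNReal.ofReal_lt_top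

variable [NormedSpace ℝ E]

theorem charFunDual_convPow (m : Measure E) [IsFiniteMeasure m] (L : StrongDual ℝ E) (n : ℕ) :
    charFunDual (convPow m n) L = charFunDual m L ^ n := by
  induction n with
  | zero => simp [convPow, charFunDual_dirac]
  | succ n ih => rw [convPow, charFunDual_conv, ih, pow_succ]

theorem charFunDual_compoundPoisson (m : Measure E) [IsFiniteMeasure m] (L : StrongDual ℝ E) :
    charFunDual (compoundPoisson m) L
      = Complex.exp (charFunDual m L - m.real Set.univ) := by
  have hint : Integrable (fun v => Complex.exp (L v * Complex.I)) (compoundPoisson m) := by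
    refine (integrable_const (1 : ℝ)).mono' (by fun_prop) (Eventually.of_forall fun v => ?_)
    rw [Complex.norm_exp_ofReal_mul_I]
  have hsum := NormedSpace.expSeries_div_hasSum_exp (charFunDual m L)
  rw [← Complex.exp_eq_exp_ℂ] at hsum
  rw [charFunDual_apply]
  rw [compoundPoisson] at hint ⊢
  rw [integral_sum_measure hint, sub_eq_neg_add, Complex.exp_add,
    ← hsum.tsum_eq, ← tsum_mul_left]
  refine tsum_congr fun n => ?_
  rw [integral_smul_measure, ← charFunDual_apply, charFunDual_convPow,
    ENNReal.toReal_ofReal (by positivity), Complex.real_smul]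
  push_cast
  ring

/-- Exponential moments of a law with a compound Poisson characteristic function. -/
theorem lintegral_exp_norm_le_of_charFunDual [CompleteSpace E] (m ρ : Measure E)
    [IsFiniteMeasure m] [IsFiniteMeasure ρ]
    (hρ : ∀ L : StrongDual ℝ E,
      charFunDual ρ L = Complex.exp (charFunDual m L - m.real Set.univ))
    {θ C : ℝ} (hθ : 0 ≤ θ) (hC0 : 0 ≤ C)
    (hC : ∫⁻ v, ENNReal.ofReal (Real.exp (θ * ‖v‖) - 1) ∂m ≤ ENNReal.ofReal C) :
    ∫⁻ v, ENNReal.ofReal (Real.exp (θ * ‖v‖)) ∂ρ ≤ ENNReal.ofReal (Real.exp C) := by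
  -- A finite measure is determined by its characteristic function, so moment bounds for the
  -- explicit series apply to `ρ`.
  have hlaw : ρ = compoundPoisson m := by
    refine Measure.ext_of_charFunDual ?_
    ext L
    rw [hρ, charFunDual_compoundPoisson]
  rw [hlaw]
  refine lintegral_compoundPoisson_le m (by fun_prop) (by simp) (fun x y => ?_) hC0 ?_
  · rw [← ENNReal.ofReal_mul (Real.exp_nonneg _), ← Real.exp_add, ← mul_add]
    gcongr
    exact norm_add_le x y
  · have h1 : ∀ v : E, ENNReal.ofReal (Real.exp (θ * ‖v‖))
        = 1 + ENNReal.ofReal (Real.exp (θ * ‖v‖) - 1) := fun v => by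
      rw [← ENNReal.ofReal_one, ← ENNReal.ofReal_add zero_le_one]
      · congr 1; ring
      · have := Real.add_one_le_exp (θ * ‖v‖)
        have : 0 ≤ θ * ‖v‖ := by positivity
        linarith
    simp_rw [h1]
    rw [lintegral_add_left measurable_const, lintegral_one,
      ENNReal.ofReal_add measureReal_nonneg hC0]
    gcongr
    simp [Measure.real]

end CompoundPoisson


/-! ### The Lévy exponent of a compound Poisson field. -/

section Characteristic

/-- The Lévy characteristic `∫ (e^{its} - 1) ν(ds)` of a compound Poisson field. -/
noncomputable def poissonCharacteristic (ν : Measure ℝ) (t : ℝ) : ℂ :=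
  ∫ s : ℝ, (Complex.exp (Complex.I * t * s) - 1) ∂ν

theorem integrable_exp_sub_one (ν : Measure ℝ) [IsFiniteMeasure ν] (t : ℝ) :
    Integrable (fun s : ℝ => Complex.exp (Complex.I * t * s) - 1) ν := by
  refine Integrable.sub ?_ (integrable_const _)
  refine (integrable_const (1 : ℝ)).mono' (by fun_prop) (Eventually.of_forall fun s => ?_)
  rw [show Complex.I * t * s = ((t * s : ℝ) : ℂ) * Complex.I by push_cast; ring,
    Complex.norm_exp_ofReal_mul_I]

/-- The drift is exactly the integral of the compensator, so the two cancel. -/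
theorem levyCharacteristic_eq_poissonCharacteristic (ν : Measure ℝ) [IsFiniteMeasure ν] (t : ℝ) :
    levyCharacteristic (∫ s in {s : ℝ | 0 < |s| ∧ |s| ≤ 1}, s ∂ν) 0 ν t
      = poissonCharacteristic ν t := by
  have hms : MeasurableSet {s : ℝ | |s| ≤ 1} := measurableSet_le (by fun_prop) (by fun_prop)
  have hms' : MeasurableSet {s : ℝ | 0 < |s| ∧ |s| ≤ 1} :=
    (measurableSet_lt measurable_const measurable_id.abs).inter hms
  have hind : (∫ s in {s : ℝ | 0 < |s| ∧ |s| ≤ 1}, s ∂ν) = ∫ s in {s : ℝ | |s| ≤ 1}, s ∂ν := by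
    rw [← integral_indicator hms, ← integral_indicator hms']
    congr 1
    ext s
    by_cases h : |s| ≤ 1 <;> by_cases h0 : s = 0 <;> simp [Set.indicator, h, h0]
  have hint : Integrable ({s : ℝ | |s| ≤ 1}.indicator
      (fun s : ℝ => Complex.I * t * s)) ν := by
    refine (integrable_const (|t| : ℝ)).mono'
      ((by fun_prop : Measurable fun s : ℝ => Complex.I * t * s).indicator hms).aestronglyMeasurable
      (Eventually.of_forall fun s => ?_)
    by_cases h : |s| ≤ 1
    · simp only [Set.indicator, Set.mem_ofPred_eq, h, if_true, norm_mul, Complex.norm_I, one_mul,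
        Complex.norm_real, Real.norm_eq_abs]
      exact mul_le_of_le_one_right (abs_nonneg _) h
    · simp [Set.indicator, h]
  have hcast : (∫ s in {s : ℝ | |s| ≤ 1}, (s : ℂ) ∂ν)
      = ((∫ s in {s : ℝ | |s| ≤ 1}, s ∂ν : ℝ) : ℂ) := integral_ofReal
  rw [levyCharacteristic, integral_sub (integrable_exp_sub_one ν t) hint,
    integral_indicator hms, integral_const_mul, hind, hcast, poissonCharacteristic]
  simp only [Complex.ofReal_zero, zero_mul, zero_div, sub_zero]
  ring

/-- Integrates `|e^{its} - e^{ius}| ≤ |t - u| |s|`. Being Lipschitz and zero at `0`, the exponent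
acts continuously on `L¹` by composition. -/
theorem lipschitzWith_poissonCharacteristic (ν : Measure ℝ) [IsFiniteMeasure ν]
    (hν : Integrable (fun s : ℝ => |s|) ν) :
    LipschitzWith (∫ s, |s| ∂ν).toNNReal (poissonCharacteristic ν) := by
  refine LipschitzWith.of_dist_le_mul fun t u => ?_
  rw [Real.coe_toNNReal _ (integral_nonneg fun s => abs_nonneg s), dist_eq_norm, dist_eq_norm,
    poissonCharacteristic, poissonCharacteristic,
    ← integral_sub (integrable_exp_sub_one ν t) (integrable_exp_sub_one ν u),
    ← integral_mul_const]
  refine norm_integral_le_of_norm_le (hν.mul_const _) (Eventually.of_forall fun s => ?_)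
  have h : Complex.exp (Complex.I * t * s) - 1 - (Complex.exp (Complex.I * u * s) - 1)
      = Complex.exp (((u * s : ℝ) : ℂ) * Complex.I)
        * (Complex.exp (Complex.I * (((t - u) * s : ℝ) : ℂ)) - 1) := by
    rw [mul_sub, ← Complex.exp_add, mul_one]
    push_cast
    ring_nf
  rw [h, norm_mul, Complex.norm_exp_ofReal_mul_I, one_mul]
  refine (Real.norm_exp_I_mul_ofReal_sub_one_le).trans ?_
  rw [norm_mul, mul_comm, Real.norm_eq_abs s]

@[simp]
theorem poissonCharacteristic_zero (ν : Measure ℝ) : poissonCharacteristic ν 0 = 0 := by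
  simp [poissonCharacteristic]

end Characteristic

/-! ### Density of Schwartz functions in `L¹ ∩ L²`. -/

section Density

variable {d : ℕ}

theorem tendsto_toL1L2 {T : Type*} {l : Filter T} {f : T → Rd d → ℝ} {f₀ : Rd d → ℝ}
    (h1 : ∀ i, MemLp (f i) 1 volume) (h2 : ∀ i, MemLp (f i) 2 volume)
    (h1₀ : MemLp f₀ 1 volume) (h2₀ : MemLp f₀ 2 volume)
    (hl1 : Tendsto (fun i => eLpNorm (f i - f₀) 1 volume) l (𝓝 0))
    (hl2 : Tendsto (fun i => eLpNorm (f i - f₀) 2 volume) l (𝓝 0)) :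
    Tendsto (fun i => toL1L2 (f i) (h1 i) (h2 i)) l (𝓝 (toL1L2 f₀ h1₀ h2₀)) := by
  rw [tendsto_subtype_rng]
  refine ((WithLp.prod_continuous_toLp 2 _ _).tendsto (h1₀.toLp f₀, h2₀.toLp f₀)).comp
    (Tendsto.prodMk_nhds ?_ ?_)
  · exact (Lp.tendsto_Lp_iff_tendsto_eLpNorm'' f h1 f₀ h1₀).2 hl1
  · exact (Lp.tendsto_Lp_iff_tendsto_eLpNorm'' f h2 f₀ h2₀).2 hl2

theorem tendsto_eLpNorm_indicator_closedBall_sub {p : ℝ≥0∞} (hp0 : p ≠ 0) (hp : p ≠ ∞)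
    {f : Rd d → ℝ} (hf : MemLp f p volume) :
    Tendsto (fun n : ℕ => eLpNorm ((Metric.closedBall (0 : Rd d) n).indicator f - f) p volume)
      atTop (𝓝 0) := by
  have hp' : 0 < p.toReal := ENNReal.toReal_pos hp0 hp
  simp_rw [eLpNorm_eq_lintegral_rpow_enorm_toReal hp0 hp]
  have hlim : Tendsto (fun n : ℕ => ∫⁻ x,
      ‖((Metric.closedBall (0 : Rd d) n).indicator f - f) x‖ₑ ^ p.toReal) atTop
      (𝓝 (∫⁻ _ : Rd d, 0)) := by
    refine tendsto_lintegral_of_dominated_convergence' (fun x => ‖f x‖ₑ ^ p.toReal)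
      (fun n => ?_) (fun n => Eventually.of_forall fun x => ?_) ?_
      (Eventually.of_forall fun x => ?_)
    · exact (((hf.aestronglyMeasurable.indicator Metric.isClosed_closedBall.measurableSet).sub
        hf.aestronglyMeasurable).enorm).pow_const _
    · refine ENNReal.rpow_le_rpow ?_ hp'.le
      by_cases hx : x ∈ Metric.closedBall (0 : Rd d) n <;> simp [Set.indicator, hx]
    · have h := hf.eLpNorm_lt_top
      rw [eLpNorm_eq_lintegral_rpow_enorm_toReal hp0 hp] at h
      exact ((ENNReal.rpow_lt_top_iff_of_pos (by positivity)).1 h).ne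
    · refine tendsto_const_nhds.congr' ?_
      obtain ⟨N, hN⟩ := exists_nat_ge ‖x‖
      filter_upwards [eventually_ge_atTop N] with n hn
      have hx : x ∈ Metric.closedBall (0 : Rd d) n := by
        simpa using hN.trans (Nat.cast_le.2 hn)
      simp [Set.indicator_of_mem hx, hp']
  rw [lintegral_zero] at hlim
  have h := (ENNReal.continuous_rpow_const (y := 1 / p.toReal)).tendsto 0 |>.comp hlim
  rwa [ENNReal.zero_rpow_of_pos (by positivity)] at h

theorem memLp_two_fst (g : L1L2 d) : MemLp (g.1.fst : Rd d → ℝ) 2 volume :=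
  (memLp_congr_ae g.2).2 (Lp.memLp g.1.snd)

theorem toL1L2_fst (g : L1L2 d) :
    toL1L2 (g.1.fst : Rd d → ℝ) (Lp.memLp _) (memLp_two_fst g) = g := by
  have h : (memLp_two_fst g).toLp (g.1.fst : Rd d → ℝ) = g.1.snd := by
    rw [MemLp.toLp_congr _ (Lp.memLp g.1.snd) g.2, Lp.toLp_coeFn]
  refine Subtype.ext ?_
  change WithLp.toLp 2 (MemLp.toLp _ (Lp.memLp g.1.fst), (memLp_two_fst g).toLp _) = g.1
  rw [h, Lp.toLp_coeFn]
  rfl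

/-- Approximate `f` in `L²` by a smooth `g` and multiply by a bump `χ` equal to `1` on the ball of
radius `R`. As `f = χ f`, the error `χ (g - f)` is no larger than `g - f`, and it lives in a ball of
radius `2R`, where Hölder's inequality turns smallness in `L²` into smallness in `L¹`. -/
theorem toL1L2_mem_closure_range_schwartz {f : Rd d → ℝ} (h1 : MemLp f 1 volume)
    (h2 : MemLp f 2 volume) {R : ℝ} (hR : 0 < R) (hf : ∀ x ∉ Metric.closedBall 0 R, f x = 0) :
    toL1L2 f h1 h2 ∈ closure (Set.range (schwartzToL1L2 (d := d))) := by
  let χ : ContDiffBump (0 : Rd d) := ⟨R, 2 * R, hR, by linarith⟩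
  have happ : ∀ n : ℕ, ∃ φ : 𝓢(Rd d, ℝ),
      eLpNorm (⇑φ - f) 2 volume ≤ ENNReal.ofReal (1 / (n + 1)) ∧
      eLpNorm (⇑φ - f) 1 volume ≤ ENNReal.ofReal (1 / (n + 1))
        * volume (Metric.closedBall (0 : Rd d) (2 * R)) ^ (1 / 2 : ℝ) := by
    intro n
    obtain ⟨g, hgc, hgs, hg⟩ := MemLp.exist_eLpNorm_sub_le (by simp) (by simp) h2
      (ε := 1 / ((n : ℝ) + 1)) (by positivity)
    have hsupp : HasCompactSupport (fun x => χ x * g x) := hgc.mul_left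
    have hsmooth : ContDiff ℝ (⊤ : ℕ∞) (fun x => χ x * g x) := χ.contDiff.mul hgs
    have hle : ∀ x, ‖(⇑(hsupp.toSchwartzMap hsmooth) - f) x‖ ≤ ‖(f - g) x‖ := by
      intro x
      have : (⇑(hsupp.toSchwartzMap hsmooth) - f) x = χ x * (g x - f x) := by
        have hfx : f x = χ x * f x := by
          by_cases hx : x ∈ Metric.closedBall (0 : Rd d) R
          · rw [χ.one_of_mem_closedBall hx, one_mul]
          · rw [hf x hx, mul_zero]
        change χ x * g x - f x = _
        rw [mul_sub, ← hfx]
      rw [this, norm_mul, Pi.sub_apply, norm_sub_rev (f x)]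
      refine mul_le_of_le_one_left (norm_nonneg _) ?_
      rw [Real.norm_of_nonneg χ.nonneg]
      exact χ.le_one
    have hL2 : eLpNorm (⇑(hsupp.toSchwartzMap hsmooth) - f) 2 volume
        ≤ ENNReal.ofReal (1 / (n + 1)) := (eLpNorm_mono hle).trans hg
    refine ⟨hsupp.toSchwartzMap hsmooth, hL2, ?_⟩
    have hzero : ∀ x ∉ Metric.closedBall (0 : Rd d) (2 * R),
        (⇑(hsupp.toSchwartzMap hsmooth) - f) x = 0 := by
      intro x hx
      have hx' : 2 * R < dist x 0 := by simpa using hx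
      have hχ : χ x = 0 := χ.zero_of_le_dist hx'.le
      have hfx : f x = 0 := hf x (by simp only [Metric.mem_closedBall]; linarith)
      change χ x * g x - f x = 0
      rw [hχ, hfx, zero_mul, sub_zero]
    have hind := Set.indicator_eq_self.2 (Function.support_subset_iff'.2 hzero)
    have hmeas : AEStronglyMeasurable (⇑(hsupp.toSchwartzMap hsmooth) - f) volume :=
      (SchwartzMap.continuous _).aestronglyMeasurable.sub h1.aestronglyMeasurable
    rw [← hind, eLpNorm_indicator_eq_eLpNorm_restrict Metric.isClosed_closedBall.measurableSet]
    refine (eLpNorm_le_eLpNorm_mul_rpow_measure_univ (q := 2) (by norm_num)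
      hmeas.restrict).trans ?_
    rw [Measure.restrict_apply_univ,
      show (1 / (1 : ℝ≥0∞).toReal - 1 / (2 : ℝ≥0∞).toReal) = 1 / 2 by norm_num]
    gcongr
    exact (eLpNorm_mono_measure _ Measure.restrict_le_self).trans hL2
  choose φ hφ2 hφ1 using happ
  have hε : Tendsto (fun n : ℕ => ENNReal.ofReal (1 / ((n : ℝ) + 1))) atTop (𝓝 0) := by
    have := ENNReal.tendsto_ofReal (tendsto_one_div_add_atTop_nhds_zero_nat (𝕜 := ℝ))
    rwa [ENNReal.ofReal_zero] at this
  have hvol : volume (Metric.closedBall (0 : Rd d) (2 * R)) ^ (1 / 2 : ℝ) ≠ ∞ :=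
    ENNReal.rpow_ne_top_of_nonneg (by norm_num) measure_closedBall_lt_top.ne
  refine mem_closure_of_tendsto (f := fun n => schwartzToL1L2 (φ n)) (b := atTop) ?_
    (Eventually.of_forall fun n => ⟨φ n, rfl⟩)
  refine tendsto_toL1L2 _ _ h1 h2 ?_ ?_
  · refine tendsto_of_tendsto_of_tendsto_of_le_of_le tendsto_const_nhds ?_
      (fun _ => zero_le) hφ1
    have := ENNReal.Tendsto.mul_const hε (Or.inr hvol)
    rwa [zero_mul] at this
  · exact tendsto_of_tendsto_of_tendsto_of_le_of_le tendsto_const_nhds hε (fun _ => zero_le) hφ2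

/-- The restriction of an element of `L¹ ∩ L²` to a ball around the origin. -/
noncomputable def restrictBall (g : L1L2 d) (R : ℝ) : L1L2 d :=
  toL1L2 ((Metric.closedBall (0 : Rd d) R).indicator g.1.fst)
    ((Lp.memLp g.1.fst).indicator Metric.isClosed_closedBall.measurableSet)
    ((memLp_two_fst g).indicator Metric.isClosed_closedBall.measurableSet)

theorem restrictBall_fst (g : L1L2 d) (R : ℝ) :
    ((restrictBall g R).1.fst : Rd d → ℝ)
      =ᵐ[volume] (Metric.closedBall (0 : Rd d) R).indicator g.1.fst :=
  ((Lp.memLp g.1.fst).indicator Metric.isClosed_closedBall.measurableSet).coeFn_toLp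

theorem tendsto_restrictBall (g : L1L2 d) :
    Tendsto (fun n : ℕ => restrictBall g n) atTop (𝓝 g) := by
  have h := tendsto_toL1L2 (l := atTop)
    (f := fun n : ℕ => (Metric.closedBall (0 : Rd d) n).indicator g.1.fst)
    (fun n => (Lp.memLp g.1.fst).indicator Metric.isClosed_closedBall.measurableSet)
    (fun n => (memLp_two_fst g).indicator Metric.isClosed_closedBall.measurableSet)
    (Lp.memLp g.1.fst) (memLp_two_fst g)
    (tendsto_eLpNorm_indicator_closedBall_sub (by simp) (by simp) (Lp.memLp g.1.fst))
    (tendsto_eLpNorm_indicator_closedBall_sub (by simp) (by simp) (memLp_two_fst g))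
  rwa [toL1L2_fst] at h

/-- Schwartz functions are dense in `L¹ ∩ L²`. -/
theorem denseRange_schwartzToL1L2 : DenseRange (schwartzToL1L2 (d := d)) := by
  intro g
  refine isClosed_closure.mem_of_tendsto (tendsto_restrictBall g) ?_
  filter_upwards [eventually_gt_atTop 0] with n hn
  exact toL1L2_mem_closure_range_schwartz _ _ (Nat.cast_pos.2 hn)
    fun x hx => Set.indicator_of_notMem hx _

end Density


/-! ### Characteristic functionals of the extended field. -/

section Fields

variable {Ω : Type*} [MeasurableSpace Ω] {d : ℕ}

theorem continuous_integral_poissonCharacteristic (ν : Measure ℝ) [IsFiniteMeasure ν]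
    (hν : Integrable (fun s : ℝ => |s|) ν) :
    Continuous fun g : L1L2 d => ∫ x, poissonCharacteristic ν (g.1.fst x) := by
  have hL := lipschitzWith_poissonCharacteristic ν hν
  have h0 := poissonCharacteristic_zero ν
  have hfst : Continuous fun g : L1L2 d => g.1.fst :=
    continuous_fst.comp ((WithLp.prod_continuous_ofLp 2 _ _).comp continuous_subtype_val)
  have h := continuous_integral.comp ((hL.continuous_compLp h0).comp hfst)
  refine h.congr fun g => integral_congr_ae ?_
  exact hL.coeFn_compLp h0 g.1.fst

/-- Both sides are limits along Schwartz approximations of `g`: the left by an a.s. convergent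
subsequence and dominated convergence, the right by `L¹`-continuity of the integrated exponent. -/
theorem charFunctional_extension {μ : Measure Ω} [IsProbabilityMeasure μ] {ν : Measure ℝ}
    [IsFiniteMeasure ν] {P : 𝓢(Rd d, ℝ) → Ω → ℝ} (hP : IsCompoundPoissonField μ P ν)
    {Pext : L1L2 d → Ω → ℝ} (hPext : IsExtension μ P Pext)
    (hν : Integrable (fun s : ℝ => |s|) ν) (g : L1L2 d) :
    ∫ ω, Complex.exp (Complex.I * (Pext g ω : ℂ)) ∂μ
      = Complex.exp (∫ x, poissonCharacteristic ν (g.1.fst x)) := by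
  obtain ⟨u, hu, hlim⟩ := mem_closure_iff_seq_limit.1 (denseRange_schwartzToL1L2 g)
  choose φ hφ using hu
  obtain ⟨ns, hns, hae⟩ :=
    ((hPext.field.stochContinuous g).comp hlim).exists_seq_tendsto_ae
  have hleft : Tendsto (fun n => ∫ ω, Complex.exp (Complex.I * (Pext (u (ns n)) ω : ℂ)) ∂μ) atTop
      (𝓝 (∫ ω, Complex.exp (Complex.I * (Pext g ω : ℂ)) ∂μ)) := by
    refine tendsto_integral_of_dominated_convergence (fun _ => 1) (fun n => ?_)
      (integrable_const _) (fun n => Eventually.of_forall fun ω => ?_) ?_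
    · have := hPext.field.measurable (u (ns n))
      fun_prop
    · rw [mul_comm, Complex.norm_exp_ofReal_mul_I]
    · filter_upwards [hae] with ω hω
      exact (((by fun_prop : Continuous fun t : ℝ => Complex.exp (Complex.I * (t : ℂ))).tendsto
        _).comp hω)
  have hright : Tendsto (fun n => Complex.exp (∫ x, poissonCharacteristic ν ((u (ns n)).1.fst x)))
      atTop (𝓝 (Complex.exp (∫ x, poissonCharacteristic ν (g.1.fst x)))) :=
    ((Complex.continuous_exp.comp (continuous_integral_poissonCharacteristic ν hν)).tendsto
      g).comp (hlim.comp hns.tendsto_atTop)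
  refine tendsto_nhds_unique hleft (hright.congr fun n => ?_)
  rw [← hφ]
  set f := φ (ns n)
  calc Complex.exp (∫ x, poissonCharacteristic ν ((schwartzToL1L2 f).1.fst x))
      = Complex.exp (∫ x, levyCharacteristic (∫ s in {s : ℝ | 0 < |s| ∧ |s| ≤ 1}, s ∂ν) 0 ν
          (f x)) := by
        congr 1
        refine integral_congr_ae ?_
        filter_upwards [(f.memLp 1 volume).coeFn_toLp] with x hx
        rw [levyCharacteristic_eq_poissonCharacteristic]
        exact congrArg _ hx
    _ = ∫ ω, Complex.exp (Complex.I * (P f ω : ℂ)) ∂μ := (hP.levy.charFunctional f).symm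
    _ = ∫ ω, Complex.exp (Complex.I * (Pext (schwartzToL1L2 f) ω : ℂ)) ∂μ := by
        refine integral_congr_ae ?_
        filter_upwards [hPext.agree f] with ω hω
        rw [hω]

theorem IsGeneralizedRandomField.sum_ae {V : Type*} [AddCommGroup V] [Module ℝ V]
    [TopologicalSpace V] {μ : Measure Ω} {Z : V → Ω → ℝ} (hZ : IsGeneralizedRandomField μ Z)
    {ι : Type*} (s : Finset ι) (c : ι → ℝ) (g : ι → V) :
    Z (∑ j ∈ s, c j • g j) =ᵐ[μ] fun ω => ∑ j ∈ s, c j * Z (g j) ω := by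
  classical
  induction s using Finset.induction_on with
  | empty =>
    -- Almost sure linearity with zero coefficients yields `Z 0 = 0` a.s.
    have h := hZ.linear 0 0 0 0
    simpa using h
  | insert a s ha ih =>
    have h := hZ.linear (c a) 1 (g a) (∑ j ∈ s, c j • g j)
    rw [one_smul] at h
    simp only [Finset.sum_insert ha]
    filter_upwards [h, ih] with ω h1 h2
    rw [h1, h2, one_mul]

theorem coeFn_sum_smul_fst {ι : Type*} (s : Finset ι) (c : ι → ℝ) (g : ι → L1L2 d) :
    ((∑ j ∈ s, c j • g j : L1L2 d).1.fst : Rd d → ℝ)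
      =ᵐ[volume] fun x => ∑ j ∈ s, c j * (g j).1.fst x := by
  classical
  induction s using Finset.induction_on with
  | empty => exact Lp.coeFn_zero ℝ 1 (volume : Measure (Rd d))
  | insert a s ha ih =>
    simp only [Finset.sum_insert ha]
    have h1 : (c a • g a + ∑ j ∈ s, c j • g j : L1L2 d).1.fst
        = c a • (g a).1.fst + (∑ j ∈ s, c j • g j : L1L2 d).1.fst := rfl
    rw [h1]
    filter_upwards [ih, Lp.coeFn_add (c a • (g a).1.fst) (∑ j ∈ s, c j • g j : L1L2 d).1.fst,
      Lp.coeFn_smul (c a) (g a).1.fst] with x h2 h3 h4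
    rw [h3, Pi.add_apply, h4, h2, Pi.smul_apply, smul_eq_mul]

/-- Cramér–Wold: a linear form of the vector is a.s. the field at the same linear combination of the
`g j`. -/
theorem charFunDual_extension {μ : Measure Ω} [IsProbabilityMeasure μ] {ν : Measure ℝ}
    [IsFiniteMeasure ν] {P : 𝓢(Rd d, ℝ) → Ω → ℝ} (hP : IsCompoundPoissonField μ P ν)
    {Pext : L1L2 d → Ω → ℝ} (hPext : IsExtension μ P Pext)
    (hν : Integrable (fun s : ℝ => |s|) ν) {ι : Type*} [Fintype ι] (g : ι → L1L2 d)
    (L : StrongDual ℝ (ι → ℝ)) :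
    charFunDual (μ.map fun ω j => Pext (g j) ω) L
      = Complex.exp (∫ x, poissonCharacteristic ν (L fun j => (g j).1.fst x)) := by
  classical
  have hL : ∀ v : ι → ℝ, L v = ∑ j, L (Pi.single j 1) * v j := by
    intro v
    conv_lhs => rw [← Finset.univ_sum_single v, map_sum]
    refine Finset.sum_congr rfl fun j _ => ?_
    rw [show Pi.single j (v j) = v j • (Pi.single j 1 : ι → ℝ) by
      rw [← Pi.single_smul, smul_eq_mul, mul_one], map_smul, smul_eq_mul, mul_comm]
  have hmeas : Measurable fun ω j => Pext (g j) ω :=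
    measurable_pi_lambda _ fun j => hPext.field.measurable (g j)
  rw [charFunDual_apply, integral_map hmeas.aemeasurable (by fun_prop)]
  have h := charFunctional_extension hP hPext hν (∑ j, L (Pi.single j 1) • g j)
  convert h using 1
  · refine integral_congr_ae ?_
    filter_upwards [hPext.field.sum_ae Finset.univ (fun j => L (Pi.single j 1)) g] with ω hω
    rw [hω, hL, mul_comm]
  · congr 1
    refine integral_congr_ae ?_
    filter_upwards [coeFn_sum_smul_fst Finset.univ (fun j => L (Pi.single j 1)) g] with x hx
    rw [hx, hL]

end Fields


/-! ### Jump measures and the tail of finite maxima. -/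

section TailBound

variable {Ω : Type*} [MeasurableSpace Ω] {d : ℕ}

/-- The jump measure of the vector of a compound Poisson field with Lévy measure `ν` integrated
against the components of `F` over `B`: the image of `ν ⊗ dy` under `(s, y) ↦ s F(y)`. -/
noncomputable def jumpMeasure {E : Type*} [NormedAddCommGroup E] [NormedSpace ℝ E]
    [MeasurableSpace E] (ν : Measure ℝ) (B : Set (Rd d)) (F : Rd d → E) : Measure E :=
  (ν.prod (volume.restrict B)).map fun q => q.1 • F q.2

section JumpMeasure

variable {E : Type*} [NormedAddCommGroup E] [NormedSpace ℝ E] [MeasurableSpace E]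

theorem isFiniteMeasure_jumpMeasure (ν : Measure ℝ) [IsFiniteMeasure ν] {B : Set (Rd d)}
    (hB : volume B ≠ ∞) (F : Rd d → E) : IsFiniteMeasure (jumpMeasure ν B F) := by
  have : IsFiniteMeasure (volume.restrict B) := isFiniteMeasure_restrict.2 hB
  unfold jumpMeasure
  infer_instance

variable [BorelSpace E] [SecondCountableTopology E]

/-- Fubini for `e^{i s L(F(y))} - 1`; this matches the exponent of the field with that of a compound
Poisson law. Finite volume of `B` keeps the jump measure finite. -/
theorem charFunDual_jumpMeasure_sub (ν : Measure ℝ) [IsFiniteMeasure ν] {B : Set (Rd d)}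
    (hB : volume B ≠ ∞) {F : Rd d → E} (hF : Measurable F) (L : StrongDual ℝ E) :
    charFunDual (jumpMeasure ν B F) L - (jumpMeasure ν B F).real Set.univ
      = ∫ y in B, poissonCharacteristic ν (L (F y)) := by
  have : IsFiniteMeasure (volume.restrict B) := isFiniteMeasure_restrict.2 hB
  have := isFiniteMeasure_jumpMeasure ν hB F
  have hmap : Measurable fun q : ℝ × Rd d => q.1 • F q.2 := by fun_prop
  have hint : Integrable (fun v => Complex.exp (L v * Complex.I)) (jumpMeasure ν B F) := by
    refine (integrable_const (1 : ℝ)).mono' (by fun_prop) (Eventually.of_forall fun v => ?_)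
    rw [Complex.norm_exp_ofReal_mul_I]
  have h1 : charFunDual (jumpMeasure ν B F) L - (jumpMeasure ν B F).real Set.univ
      = ∫ v, (Complex.exp (L v * Complex.I) - 1) ∂(jumpMeasure ν B F) := by
    rw [integral_sub hint (integrable_const _), charFunDual_apply]
    simp
  have hint' : Integrable (fun q : ℝ × Rd d => Complex.exp (L (q.1 • F q.2) * Complex.I) - 1)
      (ν.prod (volume.restrict B)) :=
    (integrable_map_measure (by fun_prop) hmap.aemeasurable).1 (hint.sub (integrable_const 1))
  rw [h1, jumpMeasure, integral_map hmap.aemeasurable (by fun_prop),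
    integral_prod_symm _ hint']
  refine integral_congr_ae (Eventually.of_forall fun y => ?_)
  refine integral_congr_ae (Eventually.of_forall fun s => ?_)
  simp only [map_smul, smul_eq_mul, Complex.ofReal_mul]
  ring_nf

/-- In `e^x - 1 ≤ x e^x` with `x = θ |s| ‖F y‖`, the factor `‖F y‖` in front is integrated to `κ1`
and the one in the exponential is bounded by `κinf`. -/
theorem lintegral_jumpMeasure_le (ν : Measure ℝ) [IsFiniteMeasure ν] {B : Set (Rd d)}
    {F : Rd d → E} (hF : Measurable F) {θ κ1 κinf A : ℝ} (hθ : 0 ≤ θ) (hκ1 : 0 ≤ κ1)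
    (hF1 : ∫⁻ y, ‖F y‖ₑ ≤ ENNReal.ofReal κ1) (hFinf : ∀ᵐ y, ‖F y‖ ≤ κinf)
    (hA : ∫⁻ s, ENNReal.ofReal (|s| * Real.exp (θ * κinf * |s|)) ∂ν ≤ ENNReal.ofReal A) :
    ∫⁻ v, ENNReal.ofReal (Real.exp (θ * ‖v‖) - 1) ∂(jumpMeasure ν B F)
      ≤ ENNReal.ofReal (θ * κ1 * A) := by
  have hmap : Measurable fun q : ℝ × Rd d => q.1 • F q.2 := by fun_prop
  have hexp : ∀ x : ℝ, Real.exp x - 1 ≤ x * Real.exp x := fun x => by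
    -- Multiplying `1 - x ≤ e^{-x}` by `e^x` gives the inequality.
    have h := Real.add_one_le_exp (-x)
    have h2 : Real.exp (-x) * Real.exp x = 1 := by rw [← Real.exp_add]; simp
    nlinarith [Real.exp_pos x]
  rw [jumpMeasure, lintegral_map (by fun_prop) hmap, lintegral_prod _ (by fun_prop)]
  calc ∫⁻ s, (∫⁻ y in B, ENNReal.ofReal (Real.exp (θ * ‖s • F y‖) - 1)) ∂ν
      ≤ ∫⁻ s, (∫⁻ y, ENNReal.ofReal (θ * (|s| * Real.exp (θ * κinf * |s|))) * ‖F y‖ₑ) ∂ν := by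
        refine lintegral_mono fun s => (setLIntegral_le_lintegral _ _).trans ?_
        refine lintegral_mono_ae ?_
        filter_upwards [hFinf] with y hy
        rw [← ofReal_norm, ← ENNReal.ofReal_mul (by positivity)]
        refine ENNReal.ofReal_le_ofReal ((hexp _).trans ?_)
        rw [norm_smul, Real.norm_eq_abs]
        have : Real.exp (θ * (|s| * ‖F y‖)) ≤ Real.exp (θ * κinf * |s|) := by
          refine Real.exp_le_exp.2 ?_
          calc θ * (|s| * ‖F y‖) ≤ θ * (|s| * κinf) := by gcongr
            _ = _ := by ring
        calc θ * (|s| * ‖F y‖) * Real.exp (θ * (|s| * ‖F y‖))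
            ≤ θ * (|s| * ‖F y‖) * Real.exp (θ * κinf * |s|) := by gcongr
          _ = _ := by ring
    _ = ∫⁻ s, ENNReal.ofReal θ * ENNReal.ofReal (|s| * Real.exp (θ * κinf * |s|))
          * (∫⁻ y, ‖F y‖ₑ) ∂ν := by
        refine lintegral_congr fun s => ?_
        rw [lintegral_const_mul _ hF.enorm, ENNReal.ofReal_mul hθ]
    _ = ENNReal.ofReal θ * (∫⁻ s, ENNReal.ofReal (|s| * Real.exp (θ * κinf * |s|)) ∂ν)
          * ∫⁻ y, ‖F y‖ₑ := by
        rw [lintegral_mul_const _ (by fun_prop), lintegral_const_mul _ (by fun_prop)]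
    _ ≤ ENNReal.ofReal θ * ENNReal.ofReal A * ENNReal.ofReal κ1 := by gcongr
    _ = ENNReal.ofReal (θ * κ1 * A) := by
        rw [← ENNReal.ofReal_mul hθ, mul_right_comm, ENNReal.ofReal_mul' hκ1]

end JumpMeasure

/-- Chernoff's bound: the norm on `ι → ℝ` is the sup norm, so one exponential moment controls all
coordinates at once. -/
theorem measure_exists_ge_le_of_lintegral {μ : Measure Ω} {ι : Type*} [Fintype ι] {X : ι → Ω → ℝ}
    (hX : ∀ j, Measurable (X j)) {θ C : ℝ} (hθ : 0 ≤ θ)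
    (h : ∫⁻ v, ENNReal.ofReal (Real.exp (θ * ‖v‖)) ∂(μ.map fun ω j => X j ω)
      ≤ ENNReal.ofReal (Real.exp C)) (p : ℝ) :
    μ {ω | ∃ j, p ≤ |X j ω|} ≤ ENNReal.ofReal (Real.exp (C - θ * p)) := by
  have hX' : Measurable fun ω j => X j ω := measurable_pi_lambda _ hX
  rw [lintegral_map (by fun_prop) hX'] at h
  calc μ {ω | ∃ j, p ≤ |X j ω|}
      ≤ μ {ω | ENNReal.ofReal (Real.exp (θ * p))
          ≤ ENNReal.ofReal (Real.exp (θ * ‖fun j => X j ω‖))} := by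
        refine measure_mono ?_
        rintro ω ⟨j, hj⟩
        refine ENNReal.ofReal_le_ofReal (Real.exp_le_exp.2 ?_)
        exact mul_le_mul_of_nonneg_left (hj.trans (norm_le_pi_norm (fun j => X j ω) j)) hθ
    _ ≤ (∫⁻ ω, ENNReal.ofReal (Real.exp (θ * ‖fun j => X j ω‖)) ∂μ)
          / ENNReal.ofReal (Real.exp (θ * p)) :=
        meas_ge_le_lintegral_div (by fun_prop) (by simp [Real.exp_pos]) ENNReal.ofReal_ne_top
    _ ≤ ENNReal.ofReal (Real.exp C) / ENNReal.ofReal (Real.exp (θ * p)) := by gcongr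
    _ = _ := by rw [← ENNReal.ofReal_div_of_pos (Real.exp_pos _), Real.exp_sub]

variable {μ : Measure Ω} [IsProbabilityMeasure μ] {ν : Measure ℝ}
  [IsFiniteMeasure ν] {P : 𝓢(Rd d, ℝ) → Ω → ℝ} {Pext : L1L2 d → Ω → ℝ}

theorem lintegral_exp_norm_extension_le (hP : IsCompoundPoissonField μ P ν)
    (hPext : IsExtension μ P Pext) (hν : Integrable (fun s : ℝ => |s|) ν)
    {ι : Type*} [Fintype ι] (g : ι → L1L2 d) {R : ℝ}
    (hg : ∀ᵐ y, y ∉ Metric.closedBall (0 : Rd d) R → ∀ j, (g j).1.fst y = 0)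
    {θ κ1 κinf A : ℝ} (hθ : 0 ≤ θ) (hκ1 : 0 ≤ κ1) (hA0 : 0 ≤ A)
    (hF1 : ∫⁻ y, ‖fun j => (g j).1.fst y‖ₑ ≤ ENNReal.ofReal κ1)
    (hFinf : ∀ᵐ y, ‖fun j => (g j).1.fst y‖ ≤ κinf)
    (hA : ∫⁻ s, ENNReal.ofReal (|s| * Real.exp (θ * κinf * |s|)) ∂ν ≤ ENNReal.ofReal A) :
    ∫⁻ v, ENNReal.ofReal (Real.exp (θ * ‖v‖)) ∂(μ.map fun ω j => Pext (g j) ω)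
      ≤ ENNReal.ofReal (Real.exp (θ * κ1 * A)) := by
  have hB : volume (Metric.closedBall (0 : Rd d) R) ≠ ∞ := measure_closedBall_lt_top.ne
  have hF : Measurable fun y j => (g j).1.fst y :=
    measurable_pi_lambda _ fun j => (Lp.stronglyMeasurable (g j).1.fst).measurable
  have := isFiniteMeasure_jumpMeasure ν hB fun y j => (g j).1.fst y
  refine lintegral_exp_norm_le_of_charFunDual
    (jumpMeasure ν (Metric.closedBall (0 : Rd d) R) fun y j => (g j).1.fst y) _
    (fun L => ?_) hθ (by positivity) (lintegral_jumpMeasure_le ν hF hθ hκ1 hF1 hFinf hA)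
  rw [charFunDual_extension hP hPext hν, charFunDual_jumpMeasure_sub ν hB hF]
  congr 1
  -- Outside the ball the vector vanishes, and the exponent is zero at `0`.
  refine (setIntegral_eq_integral_of_ae_compl_eq_zero ?_).symm
  filter_upwards [hg] with y hy hyB
  rw [show (fun j => (g j).1.fst y) = 0 from funext (hy hyB), map_zero, poissonCharacteristic_zero]

theorem le_ofReal_exp_of_forall_pos {x : ℝ≥0∞} {a θ : ℝ}
    (h : ∀ ε > 0, x ≤ ENNReal.ofReal (Real.exp (a + θ * ε))) :
    x ≤ ENNReal.ofReal (Real.exp a) := by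
  have hlim : Tendsto (fun ε : ℝ => ENNReal.ofReal (Real.exp (a + θ * ε))) (𝓝[>] 0)
      (𝓝 (ENNReal.ofReal (Real.exp a))) := by
    have hc : Continuous fun ε : ℝ => ENNReal.ofReal (Real.exp (a + θ * ε)) :=
      ENNReal.continuous_ofReal.comp (by fun_prop)
    have := (hc.tendsto 0).mono_left (nhdsWithin_le_nhds (s := Set.Ioi 0))
    simpa using this
  exact ge_of_tendsto hlim (eventually_nhdsWithin_of_forall h)

/-- The tail bound for the maximum of finitely many integrals of a compound Poisson field. -/
theorem measure_exists_ge_le (hP : IsCompoundPoissonField μ P ν)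
    (hPext : IsExtension μ P Pext) (hν : Integrable (fun s : ℝ => |s|) ν)
    {ι : Type*} [Fintype ι] (g : ι → L1L2 d)
    {θ κ1 κinf A : ℝ} (hθ : 0 ≤ θ) (hκ1 : 0 ≤ κ1) (hA0 : 0 ≤ A)
    (hF1 : ∫⁻ y, ‖fun j => (g j).1.fst y‖ₑ ≤ ENNReal.ofReal κ1)
    (hFinf : ∀ᵐ y, ‖fun j => (g j).1.fst y‖ ≤ κinf)
    (hA : ∫⁻ s, ENNReal.ofReal (|s| * Real.exp (θ * κinf * |s|)) ∂ν ≤ ENNReal.ofReal A) (p : ℝ) :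
    μ {ω | ∃ j, p ≤ |Pext (g j) ω|} ≤ ENNReal.ofReal (Real.exp (θ * κ1 * A - θ * p)) := by
  -- Lowering the level from `p` to `p - ε` costs a factor `e^{θ ε}` and absorbs the error of
  -- truncating the `g j` to balls, whose probability of exceeding `ε` tends to zero.
  refine le_ofReal_exp_of_forall_pos (θ := θ) fun ε hε => ?_
  have hcoe : ∀ n : ℕ, ∀ᵐ y, ∀ j, (restrictBall (g j) n).1.fst y
      = (Metric.closedBall (0 : Rd d) n).indicator (g j).1.fst y :=
    fun n => ae_all_iff.2 fun j => restrictBall_fst (g j) n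
  have hle : ∀ n : ℕ, ∀ᵐ y, ‖fun j => (restrictBall (g j) n).1.fst y‖
      ≤ ‖fun j => (g j).1.fst y‖ := fun n => by
    filter_upwards [hcoe n] with y hy
    refine (pi_norm_le_iff_of_nonneg (norm_nonneg _)).2 fun j => ?_
    rw [hy j]
    exact (norm_indicator_le_norm_self _ _).trans (norm_le_pi_norm (fun j => (g j).1.fst y) j)
  have hbound : ∀ n : ℕ, μ {ω | ∃ j, p - ε ≤ |Pext (restrictBall (g j) n) ω|}
      ≤ ENNReal.ofReal (Real.exp (θ * κ1 * A - θ * p + θ * ε)) := fun n => by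
    have h := measure_exists_ge_le_of_lintegral
      (fun j => hPext.field.measurable (restrictBall (g j) n)) hθ
      (lintegral_exp_norm_extension_le hP hPext hν (fun j => restrictBall (g j) n)
        (R := n) ?_ hθ hκ1 hA0 ?_ ?_ hA) (p - ε)
    · rwa [show θ * κ1 * A - θ * (p - ε) = θ * κ1 * A - θ * p + θ * ε by ring] at h
    · filter_upwards [hcoe n] with y hy hyB j
      rw [hy j, Set.indicator_of_notMem hyB]
    · refine (lintegral_mono_ae ?_).trans hF1
      filter_upwards [hle n] with y hy
      exact enorm_le_iff_norm_le.2 hy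
    · filter_upwards [hle n, hFinf] with y h1 h2 using h1.trans h2
  have hstep : ∀ n : ℕ, μ {ω | ∃ j, p ≤ |Pext (g j) ω|}
      ≤ ENNReal.ofReal (Real.exp (θ * κ1 * A - θ * p + θ * ε))
        + ∑ j, μ {ω | ENNReal.ofReal ε ≤ edist (Pext (restrictBall (g j) n) ω) (Pext (g j) ω)} := by
    intro n
    refine le_trans ?_ (add_le_add_left (hbound n) _)
    refine le_trans (measure_mono ?_) ((measure_union_le _ _).trans
      (add_le_add_right (measure_iUnion_fintype_le _ _) _))
    rintro ω ⟨j, hj⟩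
    by_cases h : p - ε ≤ |Pext (restrictBall (g j) n) ω|
    · exact Or.inl ⟨j, h⟩
    · refine Or.inr (Set.mem_iUnion.2 ⟨j, ?_⟩)
      have h1 := abs_sub_abs_le_abs_sub (Pext (g j) ω) (Pext (restrictBall (g j) n) ω)
      change ENNReal.ofReal ε ≤ edist _ _
      rw [edist_dist, dist_comm, Real.dist_eq]
      refine ENNReal.ofReal_le_ofReal ?_
      linarith
  have hlim : Tendsto (fun n : ℕ => ENNReal.ofReal (Real.exp (θ * κ1 * A - θ * p + θ * ε))
        + ∑ j, μ {ω | ENNReal.ofReal ε ≤ edist (Pext (restrictBall (g j) n) ω) (Pext (g j) ω)})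
      atTop (𝓝 (ENNReal.ofReal (Real.exp (θ * κ1 * A - θ * p + θ * ε)) + ∑ _j : ι, 0)) := by
    refine tendsto_const_nhds.add (tendsto_finsetSum _ fun j _ => ?_)
    exact ((hPext.field.stochContinuous (g j)).comp (tendsto_restrictBall (g j)))
      (ENNReal.ofReal ε) (by simpa using hε)
  rw [Finset.sum_const_zero, add_zero] at hlim
  exact ge_of_tendsto' hlim hstep

end TailBound


/-! ### From finite maxima to essential and pathwise suprema. -/

section Supremum

variable {Ω : Type*} [MeasurableSpace Ω]

/-- A tail bound for finite maxima passes to the supremum of a sequence. -/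
theorem measure_ge_iSup_enorm_le {μ : Measure Ω} {X : ℕ → Ω → ℝ} {a θ : ℝ}
    (h : ∀ (N : ℕ) (p : ℝ),
      μ {ω | ∃ j : Fin N, p ≤ |X j ω|} ≤ ENNReal.ofReal (Real.exp (a - θ * p)))
    {p : ℝ} (hp : 0 < p) :
    μ {ω | ENNReal.ofReal p ≤ ⨆ n, ‖X n ω‖ₑ} ≤ ENNReal.ofReal (Real.exp (a - θ * p)) := by
  -- The supremum need not be attained, but if it is at least `p` then some index reaches `p - ε`.
  refine le_ofReal_exp_of_forall_pos (θ := θ) fun ε hε => ?_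
  have hmono : Monotone fun N : ℕ => {ω | ∃ j : Fin N, p - ε ≤ |X j ω|} := by
    rintro N N' hN ω ⟨j, hj⟩
    exact ⟨Fin.castLE hN j, hj⟩
  calc μ {ω | ENNReal.ofReal p ≤ ⨆ n, ‖X n ω‖ₑ}
      ≤ μ (⋃ N : ℕ, {ω | ∃ j : Fin N, p - ε ≤ |X j ω|}) := by
        refine measure_mono fun ω hω => ?_
        by_contra hcon
        have hlt : ∀ n, |X n ω| < p - ε := fun n => by
          by_contra hn
          exact hcon (Set.mem_iUnion.2 ⟨n + 1, ⟨⟨n, n.lt_succ_self⟩, not_lt.1 hn⟩⟩)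
        have hle : ⨆ n, ‖X n ω‖ₑ ≤ ENNReal.ofReal (p - ε) := iSup_le fun n => by
          rw [← ofReal_norm]
          exact ENNReal.ofReal_le_ofReal (hlt n).le
        have hlt' : ENNReal.ofReal (p - ε) < ENNReal.ofReal p :=
          (ENNReal.ofReal_lt_ofReal_iff hp).2 (by linarith)
        exact absurd (le_trans hω hle) (not_le.2 hlt')
    _ = ⨆ N : ℕ, μ {ω | ∃ j : Fin N, p - ε ≤ |X j ω|} := hmono.measure_iUnion
    _ ≤ ENNReal.ofReal (Real.exp (a - θ * p + θ * ε)) := by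
        refine iSup_le fun N => (h N (p - ε)).trans (le_of_eq ?_)
        congr 2
        ring

/-- The essential supremum of a field that is continuous in probability is the supremum over a
dense sequence. -/
theorem isEssSupOfFamily_of_dense {T : Type*} [TopologicalSpace T] [FirstCountableTopology T]
    {μ : Measure Ω} {D : Set T} {Y : T → Ω → ℝ} (hY : ∀ x, Measurable (Y x))
    (hcont : ∀ x, TendstoInMeasure μ Y (𝓝 x) (Y x)) {u : ℕ → T} (hu : ∀ n, u n ∈ D)
    (hdense : D ⊆ closure (Set.range u)) :
    IsEssSupOfFamily μ D (fun x ω => ‖Y x ω‖ₑ) (fun ω => ⨆ n, ‖Y (u n) ω‖ₑ) where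
  measurable := Measurable.iSup fun n => (hY (u n)).enorm
  le := by
    intro x hx
    obtain ⟨v, hv, hlim⟩ := mem_closure_iff_seq_limit.1 (hdense hx)
    -- Along an a.s. convergent subsequence of points of the dense sequence, the bound by their
    -- supremum passes to the limit.
    obtain ⟨ns, -, hae⟩ := ((hcont x).comp hlim).exists_seq_tendsto_ae
    filter_upwards [hae] with ω hω
    refine le_of_tendsto' ((continuous_enorm.tendsto _).comp hω) fun n => ?_
    obtain ⟨m, hm⟩ := hv (ns n)
    simp only [Function.comp_apply, ← hm]
    exact le_iSup (fun n => ‖Y (u n) ω‖ₑ) m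
  least := by
    intro M' _ hM'
    filter_upwards [ae_all_iff.2 fun n => hM' (u n) (hu n)] with ω hω using iSup_le hω

/-- Countability of `S` lets the null sets, one for each point, be discarded together. -/
theorem tail_version_le {T : Type*} {μ : Measure Ω} {D : Set T} {Z Y : T → Ω → ℝ}
    {M : Ω → ℝ≥0∞} (hM : IsEssSupOfFamily μ D (fun x ω => ‖Z x ω‖ₑ) M)
    (hY : ∀ x ∈ D, Y x =ᵐ[μ] Z x) (hsup : HasCountableSup μ D Y) (c : ℝ≥0∞) :
    μ {ω | c ≤ ⨆ x ∈ D, ‖Y x ω‖ₑ} ≤ μ {ω | c ≤ M ω} := by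
  obtain ⟨S, hSD, hS, hae⟩ := hsup
  refine measure_mono_ae ?_
  filter_upwards [hae, (ae_ball_iff hS).2 fun x hx => hM.le x (hSD hx),
    (ae_ball_iff hS).2 fun x hx => hY x (hSD hx)] with ω h1 h2 h3 hω
  have hω' : c ≤ ⨆ x ∈ D, ‖Y x ω‖ₑ := hω
  rw [h1] at hω'
  refine hω'.trans (iSup₂_le fun x hx => ?_)
  rw [h3 x hx]
  exact h2 x hx

end Supremum

/-! ### The constant built from the Lévy measure. -/

section LevyMeasure

theorem isFiniteMeasure_absMeasure (ν : Measure ℝ) [IsFiniteMeasure ν] :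
    IsFiniteMeasure (absMeasure ν) := by
  unfold absMeasure
  infer_instance

theorem integrable_exp_of_lintegral_sub_one {ρ : Measure ℝ} [IsFiniteMeasure ρ] {β : ℝ}
    (h : ∫⁻ s, ENNReal.ofReal (Real.exp (β * s) - 1) ∂ρ < ∞) :
    Integrable (fun s => Real.exp (β * s)) ρ := by
  refine ⟨by fun_prop, ?_⟩
  rw [hasFiniteIntegral_iff_ofReal (Eventually.of_forall fun s => (Real.exp_pos _).le)]
  calc ∫⁻ s, ENNReal.ofReal (Real.exp (β * s)) ∂ρ
      ≤ ∫⁻ s, (ENNReal.ofReal (Real.exp (β * s) - 1) + 1) ∂ρ := by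
        refine lintegral_mono fun s => ?_
        rw [← ENNReal.ofReal_one]
        refine le_trans (le_of_eq ?_) ENNReal.ofReal_add_le
        congr 1
        ring
    _ < ∞ := by
        rw [lintegral_add_right _ measurable_const, lintegral_one]
        exact ENNReal.add_lt_top.2 ⟨h, measure_lt_top _ _⟩

/-- This is `x ≤ e^{x - 1}` at `x = β (1 - τ) s`, multiplied by `e · e^{β τ s}`. -/
theorem mul_exp_le_of_lt_one {β τ : ℝ} (hβ : 0 < β) (hτ : τ < 1) (s : ℝ) :
    s * Real.exp (β * τ * s) ≤ 1 / (β * Real.exp 1 * (1 - τ)) * Real.exp (β * s) := by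
  have h1 : 0 < β * Real.exp 1 * (1 - τ) :=
    mul_pos (mul_pos hβ (Real.exp_pos 1)) (by linarith)
  have h2 := Real.add_one_le_exp (β * (1 - τ) * s - 1)
  have h3 : Real.exp (β * s)
      = Real.exp (β * (1 - τ) * s - 1) * (Real.exp 1 * Real.exp (β * τ * s)) := by
    rw [← Real.exp_add, ← Real.exp_add]
    congr 1
    ring
  rw [one_div, inv_mul_eq_div, le_div_iff₀ h1, h3]
  calc s * Real.exp (β * τ * s) * (β * Real.exp 1 * (1 - τ))
      = (β * (1 - τ) * s - 1 + 1) * (Real.exp 1 * Real.exp (β * τ * s)) := by ring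
    _ ≤ _ := by gcongr

/-- Split at `|s| = 1`: small jumps use `e^{β τ |s|} ≤ e^β`, large ones trade the factor `|s|` for
the remaining exponential rate `β (1 - τ)`. -/
theorem lintegral_abs_mul_exp_le {ν : Measure ℝ} [IsFiniteMeasure ν] {β τ : ℝ} (hβ : 0 < β)
    (hτ : τ < 1)
    (hνβ : ∫⁻ s, ENNReal.ofReal (Real.exp (β * s) - 1) ∂(absMeasure ν) < ∞) :
    ∫⁻ s, ENNReal.ofReal (|s| * Real.exp (β * τ * |s|)) ∂ν
      ≤ ENNReal.ofReal (Real.exp β * ∫ s in Set.Ioc 0 1, |s| ∂(absMeasure ν)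
          + 1 / (β * Real.exp 1 * (1 - τ)) *
            ∫ s in Set.Ioi 1, Real.exp (β * s) ∂(absMeasure ν)) := by
  have := isFiniteMeasure_absMeasure ν
  have hc : 0 ≤ 1 / (β * Real.exp 1 * (1 - τ)) := by
    have : 0 ≤ 1 - τ := by linarith
    positivity
  have hexp := integrable_exp_of_lintegral_sub_one hνβ
  have habs : IntegrableOn (fun s : ℝ => |s|) (Set.Ioc 0 1) (absMeasure ν) := by
    refine (integrable_const (1 : ℝ)).mono' (by fun_prop) ?_
    filter_upwards [ae_restrict_mem measurableSet_Ioc] with s hs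
    rw [Real.norm_eq_abs, abs_abs, abs_of_pos hs.1]
    exact hs.2
  set h : ℝ → ℝ≥0∞ := fun s =>
    (Set.Ioc (0 : ℝ) 1).indicator (fun s => ENNReal.ofReal (Real.exp β * |s|)) s
      + (Set.Ioi (1 : ℝ)).indicator
        (fun s => ENNReal.ofReal (1 / (β * Real.exp 1 * (1 - τ)) * Real.exp (β * s))) s with hh
  have hm1 : Measurable ((Set.Ioc (0 : ℝ) 1).indicator
      (fun s => ENNReal.ofReal (Real.exp β * |s|))) :=
    Measurable.indicator (by fun_prop) measurableSet_Ioc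
  have hm2 : Measurable ((Set.Ioi (1 : ℝ)).indicator
      (fun s => ENNReal.ofReal (1 / (β * Real.exp 1 * (1 - τ)) * Real.exp (β * s)))) :=
    Measurable.indicator (by fun_prop) measurableSet_Ioi
  calc ∫⁻ s, ENNReal.ofReal (|s| * Real.exp (β * τ * |s|)) ∂ν
      ≤ ∫⁻ s, h |s| ∂ν := by
        refine lintegral_mono fun s => ?_
        rcases (abs_nonneg s).eq_or_lt with h0 | h0
        · simp [← h0]
        rcases le_or_gt |s| 1 with h1 | h1
        · refine le_add_right ?_
          rw [Set.indicator_of_mem (Set.mem_Ioc.2 ⟨h0, h1⟩), abs_abs, mul_comm]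
          refine ENNReal.ofReal_le_ofReal ?_
          gcongr
          calc β * τ * |s| ≤ β * 1 * 1 := by gcongr
            _ = β := by ring
        · refine le_add_left ?_
          rw [Set.indicator_of_mem (Set.mem_Ioi.2 h1)]
          exact ENNReal.ofReal_le_ofReal (mul_exp_le_of_lt_one hβ hτ |s|)
    _ = ∫⁻ s, h s ∂(absMeasure ν) :=
        (lintegral_map (hm1.add hm2) (by fun_prop)).symm
    _ = ENNReal.ofReal (∫ s in Set.Ioc 0 1, Real.exp β * |s| ∂(absMeasure ν))
        + ENNReal.ofReal (∫ s in Set.Ioi 1,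
            1 / (β * Real.exp 1 * (1 - τ)) * Real.exp (β * s) ∂(absMeasure ν)) := by
        rw [hh, lintegral_add_left hm1, lintegral_indicator measurableSet_Ioc,
          lintegral_indicator measurableSet_Ioi,
          ofReal_integral_eq_lintegral_ofReal (habs.const_mul _)
            (Eventually.of_forall fun s => by positivity),
          ofReal_integral_eq_lintegral_ofReal (hexp.integrableOn.const_mul _)
            (Eventually.of_forall fun s => mul_nonneg hc (Real.exp_pos _).le)]
    _ = _ := by
        rw [integral_const_mul, integral_const_mul, ← ENNReal.ofReal_add]
        · exact mul_nonneg (Real.exp_pos _).le (integral_nonneg fun s => abs_nonneg s)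
        · exact mul_nonneg hc (integral_nonneg fun s => (Real.exp_pos _).le)

end LevyMeasure

/-! ### Domination by the kernel supremum. -/

section Kernel

variable {d : ℕ} {I : Type*}

theorem enorm_pi_le {ι : Type*} [Fintype ι] {v : ι → ℝ} {c : ℝ≥0∞} (h : ∀ j, ‖v j‖ₑ ≤ c) :
    ‖v‖ₑ ≤ c := by
  induction c with
  | top => exact le_top
  | coe c => exact ENNReal.coe_le_coe.2 (pi_nnnorm_le_iff.2 fun j => ENNReal.coe_le_coe.1 (h j))

/-- The source of uniformity in the number of points. Finiteness of the index type lets the a.e.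
choices of representatives be made simultaneously. -/
theorem enorm_le_kernelSup {D : Set (Rd d)} {k : Rd d → Rd d → ℝ} (hk : IsSmoothingFunction k)
    {ι : Type*} [Fintype ι] {x : ι → Rd d} (hx : ∀ j, x j ∈ D) :
    ∀ᵐ y, ‖fun j => (toL1L2 (k (x j)) (hk.memL1 (x j)) (hk.memL2 (x j))).1.fst y‖ₑ
      ≤ kernelSup D k y := by
  filter_upwards [ae_all_iff.2 fun j => (hk.memL1 (x j)).coeFn_toLp] with y hy
  refine enorm_pi_le fun j => ?_
  refine (congrArg _ (hy j)).le.trans ?_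
  exact le_iSup₂ (f := fun x (_ : x ∈ D) => ‖k x y‖ₑ) (x j) (hx j)

theorem lintegral_kernelSup_le (D : Set (Rd d)) (k : I → Rd d → Rd d → ℝ) (i : I) :
    ∫⁻ y, kernelSup D (k i) y ≤ kernelSupNorm D k 1 := by
  refine le_trans (le_of_eq ?_) (le_iSup (fun i => eLpNorm (kernelSup D (k i)) 1 volume) i)
  rw [eLpNorm_one_eq_lintegral_enorm]
  rfl

theorem kernelSup_le_kernelSupNorm_top (D : Set (Rd d)) (k : I → Rd d → Rd d → ℝ) (i : I) :
    ∀ᵐ y, kernelSup D (k i) y ≤ kernelSupNorm D k ∞ := by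
  have h := le_iSup (fun i => eLpNorm (kernelSup D (k i)) ∞ volume) i
  simp only [eLpNorm_exponent_top] at h
  filter_upwards [ae_le_eLpNormEssSup (f := kernelSup D (k i)) (μ := volume)] with y hy
  refine le_trans hy (h.trans (le_of_eq ?_))
  simp only [kernelSupNorm, eLpNorm_exponent_top]

theorem nonempty_of_kernelSupNorm_pos {D : Set (Rd d)} {k : I → Rd d → Rd d → ℝ} {q : ℝ≥0∞}
    (h : 0 < kernelSupNorm D k q) : D.Nonempty := by
  by_contra hD
  rw [Set.not_nonempty_iff_eq_empty] at hD
  subst hD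
  have h0 : ∀ i, kernelSup ∅ (k i) = 0 := fun i => by
    ext y
    simp [kernelSup]
  simp [kernelSupNorm, h0] at h

end Kernel

end LevyField

/-! ### The tail bound for the smoothed field. -/

theorem proposition4p5 {d : ℕ} {Ω : Type*} [MeasurableSpace Ω] (μ : Measure Ω)
    [IsProbabilityMeasure μ] (ν : Measure ℝ) (β : ℝ) (hβ : 0 < β)
    -- the compound Poisson field, continuous for the norm of `L¹ ∩ L²`, and its extension
    (P : 𝓢(LevyField.Rd d, ℝ) → Ω → ℝ)
    (hP : LevyField.IsCompoundPoissonField μ P ν)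
    (hPcont : LevyField.IsTripleNormContinuous μ P)
    (Pext : LevyField.L1L2 d → Ω → ℝ)
    (hPext : LevyField.IsExtension μ P Pext)
    -- first moment and exponential moment of order `β`
    (hν1 : ∫⁻ s, ENNReal.ofReal |s| ∂ν < ∞)
    (hνβ : ∫⁻ s, ENNReal.ofReal (Real.exp (β * s) - 1) ∂(LevyField.absMeasure ν) < ∞)
    -- the domain and the family of smoothing functions
    (D : Set (LevyField.Rd d)) (hDo : IsOpen D) (hDb : Bornology.IsBounded D)
    {I : Type*} (k : I → LevyField.Rd d → LevyField.Rd d → ℝ)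
    (hk : ∀ i, LevyField.IsSmoothingFunction (k i))
    (hk1 : ∀ i, MemLp (LevyField.kernelSup D (k i)) 1 volume)
    (hkinf : ∀ i, MemLp (LevyField.kernelSup D (k i)) ∞ volume)
    (hκ1 : LevyField.kernelSupNorm D k 1 < ∞)
    (hκinf : LevyField.kernelSupNorm D k ∞ < ∞)
    (hκinf_pos : 0 < LevyField.kernelSupNorm D k ∞) :
    let κ1 : ℝ := (LevyField.kernelSupNorm D k 1).toReal
    let κinf : ℝ := (LevyField.kernelSupNorm D k ∞).toReal
    ∀ i : I,
      -- the supremum of `|P_k|` over `D` in the space of random variables modulo a.s. equality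
      ∃ M : Ω → ℝ≥0∞,
        LevyField.IsEssSupOfFamily μ D
          (fun x ω => ‖LevyField.smoothedField Pext (hk i) x ω‖ₑ) M ∧
        ∀ τ ∈ Set.Ioo (0 : ℝ) 1, ∀ p : ℝ, 0 < p →
          let bound : ℝ≥0∞ := ENNReal.ofReal
            (Real.exp (β * κ1 / κinf *
                (Real.exp β * ∫ s in Set.Ioc 0 1, |s| ∂(LevyField.absMeasure ν)
                  + 1 / (β * Real.exp 1 * (1 - τ)) *
                    ∫ s in Set.Ioi 1, Real.exp (β * s) ∂(LevyField.absMeasure ν)))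
              * Real.exp (-(β / κinf) * τ * p))
          μ {ω | ENNReal.ofReal p ≤ M ω} ≤ bound ∧
          -- the pathwise supremum over `D` of any version for which it is a countable supremum
          ∀ Y : LevyField.Rd d → Ω → ℝ,
            (∀ x ∈ D, Y x =ᵐ[μ] LevyField.smoothedField Pext (hk i) x) →
            LevyField.HasCountableSup μ D Y →
            μ {ω | ENNReal.ofReal p ≤ ⨆ x ∈ D, ‖Y x ω‖ₑ} ≤ bound := by
  intro κ1 κinf i
  have hfin := hP.finite
  have hν : Integrable (fun s : ℝ => |s|) ν :=
    ⟨by fun_prop,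
      (hasFiniteIntegral_iff_ofReal (Eventually.of_forall fun s => abs_nonneg s)).2 hν1⟩
  have hκ1_nonneg : 0 ≤ κ1 := ENNReal.toReal_nonneg
  have hκinf' : 0 < κinf := ENNReal.toReal_pos hκinf_pos.ne' hκinf.ne
  have : Nonempty D := (LevyField.nonempty_of_kernelSupNorm_pos hκinf_pos).to_subtype
  let u : ℕ → LevyField.Rd d := fun n => TopologicalSpace.denseSeq D n
  have hu : ∀ n, u n ∈ D := fun n => (TopologicalSpace.denseSeq D n).2
  have hdense : D ⊆ closure (Set.range u) := fun x hx =>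
    map_mem_closure continuous_subtype_val (TopologicalSpace.denseRange_denseSeq D ⟨x, hx⟩)
      (by rintro _ ⟨n, rfl⟩; exact ⟨n, rfl⟩)
  have hM := LevyField.isEssSupOfFamily_of_dense (μ := μ)
    (Y := LevyField.smoothedField Pext (hk i))
    (fun x => hPext.field.measurable _)
    (fun x => (hPext.field.stochContinuous _).comp ((hk i).continuous.tendsto x)) hu hdense
  refine ⟨_, hM, fun τ hτ p hp => ?_⟩
  intro bound
  have hτ1 : 0 < 1 - τ := sub_pos.2 hτ.2
  set A : ℝ := Real.exp β * ∫ s in Set.Ioc 0 1, |s| ∂(LevyField.absMeasure ν)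
    + 1 / (β * Real.exp 1 * (1 - τ)) *
      ∫ s in Set.Ioi 1, Real.exp (β * s) ∂(LevyField.absMeasure ν) with hAdef
  have hA0 : 0 ≤ A :=
    add_nonneg (mul_nonneg (Real.exp_pos _).le (integral_nonneg fun s => abs_nonneg s))
      (mul_nonneg (by positivity) (integral_nonneg fun s => (Real.exp_pos _).le))
  -- With `θ = β τ / κinf` the exponential rate `θ κinf` is `β τ < β`, within reach of the
  -- exponential moment of order `β`.
  have hA : ∫⁻ s, ENNReal.ofReal (|s| * Real.exp (β * τ / κinf * κinf * |s|)) ∂ν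
      ≤ ENNReal.ofReal A := by
    rw [div_mul_cancel₀ _ hκinf'.ne']
    exact LevyField.lintegral_abs_mul_exp_le hβ hτ.2 hνβ
  have htail : μ {ω | ENNReal.ofReal p
      ≤ ⨆ n, ‖LevyField.smoothedField Pext (hk i) (u n) ω‖ₑ} ≤ bound := by
    refine (LevyField.measure_ge_iSup_enorm_le (a := β * τ / κinf * κ1 * A)
      (θ := β * τ / κinf) (fun N q => ?_) hp).trans ?_
    · have hle := LevyField.enorm_le_kernelSup (hk i) (x := fun j : Fin N => u j) fun j => hu j
      refine LevyField.measure_exists_ge_le hP hPext hν _ (κinf := κinf)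
        (div_nonneg (mul_nonneg hβ.le hτ.1.le) hκinf'.le) hκ1_nonneg hA0 ?_ ?_ hA q
      · rw [ENNReal.ofReal_toReal hκ1.ne]
        exact (lintegral_mono_ae hle).trans (LevyField.lintegral_kernelSup_le D k i)
      · filter_upwards [hle, LevyField.kernelSup_le_kernelSupNorm_top D k i] with y h1 h2
        rw [← toReal_enorm]
        exact ENNReal.toReal_mono hκinf.ne (h1.trans h2)
    · refine ENNReal.ofReal_le_ofReal ?_
      rw [← Real.exp_add]
      refine Real.exp_le_exp.2 ?_
      -- The method gives an extra factor `τ` in this constant, dropped to reach the stated form.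
      have h1 : β * τ / κinf * κ1 * A ≤ β * κ1 / κinf * A := by
        refine mul_le_mul_of_nonneg_right ?_ hA0
        rw [div_mul_eq_mul_div]
        refine div_le_div_of_nonneg_right ?_ hκinf'.le
        have : β * τ ≤ β := mul_le_of_le_one_right hβ.le hτ.2.le
        exact mul_le_mul_of_nonneg_right this hκ1_nonneg
      have h2 : β * τ / κinf * p = β / κinf * τ * p := by ring
      linarith
  exact ⟨htail, fun Y hY hsup => (LevyField.tail_version_le hM hY hsup _).trans htail⟩
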